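/- Let $K$ be a field of characteristic $p>0$ and let $L/K$ be a finite normal field extension which is modular, i.e. $L$ is isomorphic as a $K$-algebra to a tensor product over $K$ of extensions of $K$ generated by one element. Let $e\ge 0$ be an integer such that $L^{p^e}$ is separable over $K$ (for instance the exponent of $L$ over $K$), put $K[\bar X]=K[X]/(X^{p^e})$ and $L[\bar X]=L[X]/(X^{p^e})$, and let $\mathrm{HG}(L/K)=\mathrm{Aut}(L[\bar X]/K[\bar X])$ be the Heerma--Galois group, i.e. the group of $K[\bar X]$-algebra automorphisms of $L[\bar X]$. Let $X$ be a separated scheme over $K$ and let $Z$ be a closed subscheme of $X_L=X\times_{\operatorname{Spec}K}\operatorname{Spec}L$. Then there exists a closed subscheme $Z_0\subset X$ such that $Z=Z_0\times_{\operatorname{Spec}K}\operatorname{Spec}L$ (as closed subschemes of $X_L$) if and only if the closed subscheme $Z\times_{\operatorname{Spec}L}\operatorname{Spec}L[\bar X]$ of $X_L\times_{\operatorname{Spec}L}\operatorname{Spec}L[\bar X]=X\times_{\operatorname{Spec}K}\operatorname{Spec}L[\bar X]$ is stable under the natural action of $\mathrm{HG}(L/K)$, in which $\sigma$ acts as $\mathrm{id}_X\times\operatorname{Spec}(\sigma^{-1})$.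 -/

import Mathlib

open CategoryTheory CategoryTheory.Limits AlgebraicGeometry Polynomial
open scoped TensorProduct IntermediateField

universe u

namespace HeermaGalois

/-- A finite extension `L / K` is modular if, as a `K`-algebra, it is isomorphic to a tensor product
over `K` of elementary extensions, i.e. of extensions of `K` generated by one element.
(For `L / K` finite there are only finitely many nontrivial factors, and each factor embeds
in `L`, so it is of the form `K(α)` with `α ∈ L`.) -/
def IsModular (K L : Type u) [Field K] [Field L] [Algebra K L] : Prop :=
  ∃ (n : ℕ) (α : Fin n → L), Nonempty ((⨂[K] i : Fin n, K⟮α i⟯) ≃ₐ[K] L)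

/-- The truncated polynomial ring `R[X̄] = R[X] / (X ^ n)`. -/
abbrev Trunc (R : Type u) [CommRing R] (n : ℕ) : Type u :=
  AdjoinRoot (X ^ n : R[X])

/-- The ring homomorphism `K[X̄] → L[X̄]` induced by `K → L`, sending `X̄` to `X̄`. -/
noncomputable def truncMap (K L : Type u) [Field K] [Field L] [Algebra K L] (n : ℕ) :
    Trunc K n →+* Trunc L n :=
  AdjoinRoot.map (algebraMap K L) (X ^ n) (X ^ n) (by simp)

/-- `L[X̄]` as a `K[X̄]`-algebra. -/
noncomputable instance truncAlgebra (K L : Type u) [Field K] [Field L] [Algebra K L] (n : ℕ) :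
    Algebra (Trunc K n) (Trunc L n) :=
  (truncMap K L n).toAlgebra

/-- The Heerma-Galois group `Aut(L[X̄] / K[X̄])`, with `L[X̄] = L[X] / (X ^ (p ^ e))`. -/
abbrev HG (K L : Type u) [Field K] [Field L] [Algebra K L] (p e : ℕ) : Type u :=
  Trunc L (p ^ e) ≃ₐ[Trunc K (p ^ e)] Trunc L (p ^ e)

section

variable {K : Type u} (L : Type u) [Field K] [Field L] [Algebra K L]
  {X : Scheme.{u}} (s : X ⟶ Spec (CommRingCat.of K)) (p e : ℕ)

/-- `X_L = X ⊗_K L`. -/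
noncomputable abbrev baseChange : Scheme.{u} :=
  pullback s (Spec.map (CommRingCat.ofHom (algebraMap K L)))

/-- The projection `X_L → X`. -/
noncomputable abbrev baseChangeFst : baseChange L s ⟶ X :=
  pullback.fst s (Spec.map (CommRingCat.ofHom (algebraMap K L)))

/-- The structure morphism `X_L → Spec L`. -/
noncomputable abbrev baseChangeSnd : baseChange L s ⟶ Spec (CommRingCat.of L) :=
  pullback.snd s (Spec.map (CommRingCat.ofHom (algebraMap K L)))

/-- `X_L ⊗_L L[X̄]`. -/
noncomputable abbrev truncChange : Scheme.{u} :=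
  pullback (baseChangeSnd L s)
    (Spec.map (CommRingCat.ofHom (algebraMap L (Trunc L (p ^ e)))))

/-- The projection `X_L ⊗_L L[X̄] → X_L`. -/
noncomputable abbrev truncChangeFst : truncChange L s p e ⟶ baseChange L s :=
  pullback.fst (baseChangeSnd L s)
    (Spec.map (CommRingCat.ofHom (algebraMap L (Trunc L (p ^ e)))))

/-- The structure morphism `X_L ⊗_L L[X̄] → Spec L[X̄]`. -/
noncomputable abbrev truncChangeSnd :
    truncChange L s p e ⟶ Spec (CommRingCat.of (Trunc L (p ^ e))) :=
  pullback.snd (baseChangeSnd L s)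
    (Spec.map (CommRingCat.ofHom (algebraMap L (Trunc L (p ^ e)))))

variable {L p e}

/-- The morphism `Spec σ` from `Spec L[X̄]` to itself. -/
noncomputable abbrev specMap (σ : HG K L p e) :
    Spec (CommRingCat.of (Trunc L (p ^ e))) ⟶ Spec (CommRingCat.of (Trunc L (p ^ e))) :=
  Spec.map (CommRingCat.ofHom (σ : Trunc L (p ^ e) →+* Trunc L (p ^ e)))

theorem HG_apply_algebraMap (σ : HG K L p e) (a : K) :
    σ (algebraMap L (Trunc L (p ^ e)) (algebraMap K L a)) =
      algebraMap L (Trunc L (p ^ e)) (algebraMap K L a) := by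
  have h : algebraMap L (Trunc L (p ^ e)) (algebraMap K L a) =
      algebraMap (Trunc K (p ^ e)) (Trunc L (p ^ e)) (AdjoinRoot.of _ a) := by
    change _ = truncMap K L (p ^ e) (AdjoinRoot.of _ a)
    simp [truncMap, AdjoinRoot.algebraMap_eq]
  rw [h, AlgEquiv.commutes]

theorem specMap_comp (σ : HG K L p e) :
    specMap σ ≫ Spec.map (CommRingCat.ofHom (algebraMap L (Trunc L (p ^ e)))) ≫
        Spec.map (CommRingCat.ofHom (algebraMap K L)) =
      Spec.map (CommRingCat.ofHom (algebraMap L (Trunc L (p ^ e)))) ≫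
        Spec.map (CommRingCat.ofHom (algebraMap K L)) := by
  rw [← Spec.map_comp, ← Spec.map_comp]
  congr 1
  ext a
  exact HG_apply_algebraMap σ a

/-- The endomorphism `id_X × Spec σ` of `X_L ⊗_L L[X̄] = X ⊗_K L[X̄]`. -/
noncomputable def actionMap (σ : HG K L p e) : truncChange L s p e ⟶ truncChange L s p e :=
  pullback.lift
    (pullback.lift (truncChangeFst L s p e ≫ baseChangeFst L s)
      (truncChangeSnd L s p e ≫ specMap σ ≫
        Spec.map (CommRingCat.ofHom (algebraMap L (Trunc L (p ^ e)))))
      (by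
        simp only [Category.assoc]
        rw [specMap_comp, pullback.condition, ← pullback.condition_assoc]))
    (truncChangeSnd L s p e ≫ specMap σ)
    (by rw [pullback.lift_snd, Category.assoc])

@[simp]
theorem actionMap_snd (σ : HG K L p e) :
    actionMap s σ ≫ truncChangeSnd L s p e = truncChangeSnd L s p e ≫ specMap σ := by
  exact pullback.lift_snd _ _ _

@[simp]
theorem actionMap_fst (σ : HG K L p e) :
    actionMap s σ ≫ truncChangeFst L s p e ≫ baseChangeFst L s =
      truncChangeFst L s p e ≫ baseChangeFst L s := by
  rw [actionMap, pullback.lift_fst_assoc, pullback.lift_fst]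

theorem truncChange_hom_ext {T : Scheme.{u}} {f g : T ⟶ truncChange L s p e}
    (h₁ : f ≫ truncChangeFst L s p e ≫ baseChangeFst L s =
      g ≫ truncChangeFst L s p e ≫ baseChangeFst L s)
    (h₂ : f ≫ truncChangeSnd L s p e = g ≫ truncChangeSnd L s p e) : f = g := by
  refine pullback.hom_ext (pullback.hom_ext (by simpa only [Category.assoc] using h₁) ?_) h₂
  rw [Category.assoc, Category.assoc, pullback.condition, reassoc_of% h₂]

theorem actionMap_one : actionMap s (1 : HG K L p e) = 𝟙 _ := by
  refine truncChange_hom_ext s (by simp) ?_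
  rw [actionMap_snd, Category.id_comp]
  exact (congrArg _ (Spec.map_id _)).trans (Category.comp_id _)

theorem actionMap_mul (σ τ : HG K L p e) :
    actionMap s (σ * τ) = actionMap s σ ≫ actionMap s τ := by
  refine truncChange_hom_ext s (by simp) ?_
  rw [actionMap_snd, Category.assoc, actionMap_snd, ← Category.assoc, actionMap_snd,
    Category.assoc, ← Spec.map_comp]
  rfl

/-- The natural (left) action of the Heerma-Galois group on the scheme
`X_L ⊗_L L[X̄] = X ⊗_K L[X̄]`: `σ` acts as `id_X × Spec (σ⁻¹)`. -/
noncomputable def action : HG K L p e →* Aut (truncChange L s p e) where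
  toFun σ :=
    { hom := actionMap s σ⁻¹
      inv := actionMap s σ
      hom_inv_id := by rw [← actionMap_mul, inv_mul_cancel, actionMap_one]
      inv_hom_id := by rw [← actionMap_mul, mul_inv_cancel, actionMap_one] }
  map_one' := by
    ext1
    change actionMap s (1 : HG K L p e)⁻¹ = 𝟙 _
    rw [inv_one, actionMap_one]
  map_mul' σ τ := by
    ext1
    change actionMap s (σ * τ)⁻¹ = actionMap s τ⁻¹ ≫ actionMap s σ⁻¹
    rw [mul_inv_rev, actionMap_mul]

/-- A closed subscheme `W` of `X_L ⊗_L L[X̄]` (given by its quasi-coherent ideal sheaf) is stable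
under the natural action of the Heerma-Galois group if it is equal to its scheme-theoretic
preimage under the action of each element of the group. -/
def IsStable (W : (truncChange L s p e).IdealSheafData) : Prop :=
  ∀ σ : HG K L p e, W.comap (action s σ).hom = W

end

end HeermaGalois

namespace HeermaGalois

/-! A base change is stable because every σ acts over X. For the converse, let Z₀ be the
scheme-theoretic image of Z. Checked on preimages of affine opens of X, the claim becomes: an ideal
of A ⊗ L whose extension to A ⊗ L[X̄] is stable is generated by its contraction to A.

Two facts carry this. First, an element of L fixed by the group lies in K
(`mem_range_algebraMap_of_fixed`). Modularity gives generators β i that move independently to roots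
of their minimal polynomials. If the minimal polynomial of β i is a polynomial in T^(p^m), then β i
↦ β i + X̄^(p^(e-m)) is such a move, and invariance under these moves forces separability. Normality
then provides an automorphism of L/K moving any separable element outside K.

Second, Galois descent for subspaces (`le_span_of_coordMap_mem`): the reduced echelon generators of
a stable subspace have invariant coefficients. As σ maps L into L[X̄] and not into L, this is
applied to the composites of σ with L-linear functionals L[X̄] → L. -/

variable {K L : Type u} [Field K] [Field L] [Algebra K L]

/-! ### Automorphisms of L[X̄] and their invariants in L -/

open PiTensorProduct in
/-- A modular extension is generated by elements that can be sent independently to arbitrary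
roots of their minimal polynomials. -/
theorem IsModular.exists_generators [FiniteDimensional K L] (h : IsModular K L) :
    ∃ (n : ℕ) (β : Fin n → L), IntermediateField.adjoin K (Set.range β) = ⊤ ∧
      ∀ (B : Type u) [CommRing B] [Algebra K B] (γ : Fin n → B),
        (∀ i, aeval (γ i) (minpoly K (β i)) = 0) → ∃ φ : L →ₐ[K] B, ∀ i, φ (β i) = γ i := by
  obtain ⟨n, α, ⟨Θ⟩⟩ := h
  let pb (i : Fin n) : PowerBasis K K⟮α i⟯ :=
    IntermediateField.adjoin.powerBasis (Algebra.IsIntegral.isIntegral (α i))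
  let ψ (i : Fin n) : K⟮α i⟯ →ₐ[K] L := Θ.toAlgHom.comp (singleAlgHom (R := K) (A := fun i ↦ K⟮α i⟯) i)
  let β (i : Fin n) : L := ψ i (pb i).gen
  have hβ (i : Fin n) : minpoly K (β i) = minpoly K (pb i).gen :=
    minpoly.algHom_eq (ψ i) (ψ i).injective _
  have lift (B : Type u) [CommRing B] [Algebra K B] (γ : Fin n → B)
      (hγ : ∀ i, aeval (γ i) (minpoly K (β i)) = 0) :
      ∃ φ : L →ₐ[K] B, ∀ i, φ (β i) = γ i := by
    let f (i : Fin n) : K⟮α i⟯ →ₐ[K] B := (pb i).lift (γ i) (hβ i ▸ hγ i)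
    let F : (⨂[K] i : Fin n, K⟮α i⟯) →ₐ[K] B := liftAlgHom
      ((MultilinearMap.mkPiAlgebra K (Fin n) B).compLinearMap fun i ↦ (f i).toLinearMap)
      (by simp) (by simp [Finset.prod_mul_distrib])
    refine ⟨F.comp Θ.symm.toAlgHom, fun i ↦ ?_⟩
    have hF (x : K⟮α i⟯) : F (singleAlgHom i x) = f i x := by
      have h1 : F (singleAlgHom i x) = ∏ j, f j (Pi.mulSingle (M := fun i ↦ K⟮α i⟯) i x j) := by
        change PiTensorProduct.lift _ (PiTensorProduct.tprod K _) = _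
        rw [lift.tprod]
        rfl
      rw [h1, Finset.prod_eq_single i (fun j _ hj ↦ by rw [Pi.mulSingle_eq_of_ne hj, map_one])
        (by simp), Pi.mulSingle_eq_same]
    have : Θ.symm (β i) = singleAlgHom i (pb i).gen := Θ.symm_apply_apply _
    change F (Θ.symm (β i)) = γ i
    rw [this, hF, PowerBasis.lift_gen]
  refine ⟨n, β, ?_, lift⟩
  -- Lifting into F itself gives φ : L → F with β i ↦ β i. Followed by the inclusion it is the
  -- identity, since maps out of the tensor product are determined on the factors; hence F = L.
  set F := IntermediateField.adjoin K (Set.range β)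
  let γ (i : Fin n) : F := ⟨β i, IntermediateField.subset_adjoin K _ ⟨i, rfl⟩⟩
  obtain ⟨φ, hφ⟩ := lift F γ fun i ↦ by
    have : minpoly K (β i) = minpoly K (γ i) := minpoly.algHom_eq F.val F.val.injective (γ i)
    rw [this, minpoly.aeval]
  have hid : F.val.comp φ = AlgHom.id K L := by
    have : (F.val.comp φ).comp Θ.toAlgHom = (AlgHom.id K L).comp Θ.toAlgHom := by
      refine algHom_ext fun i ↦ (pb i).algHom_ext ?_
      exact congrArg Subtype.val (hφ i)
    ext x
    simpa using DFunLike.congr_fun this (Θ.symm x)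
  rw [eq_top_iff]
  intro x _
  have := DFunLike.congr_fun hid x
  simp only [AlgHom.comp_apply, AlgHom.id_apply] at this
  rw [← this]
  exact (φ x).2

/-- If `x ^ p ^ e` is separable, then the minimal polynomial of `x` is a polynomial in `T ^ p ^ m`
for some `m ≤ e` such that `x ^ p ^ m` is separable. -/
theorem exists_minpoly_eq_expand (p : ℕ) [Fact p.Prime] [CharP K p] {x : L}
    (hx : IsIntegral K x) {e : ℕ} (he : IsSeparable K (x ^ p ^ e)) :
    ∃ m ≤ e, IsSeparable K (x ^ p ^ m) ∧ ∃ h : K[X], minpoly K x = expand K (p ^ m) h := by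
  obtain ⟨n, g, hg, hgx⟩ :=
    exists_separable_of_irreducible p (minpoly.irreducible hx) (Fact.out : p.Prime).ne_zero
  -- If the inseparability exponent n exceeds e, stop at m = e, where separability is the hypothesis
  -- `he`.
  rcases le_total n e with h | h
  · refine ⟨n, h, ?_, g, hgx.symm⟩
    refine hg.of_dvd (minpoly.dvd K _ ?_)
    rw [← expand_aeval, hgx, minpoly.aeval]
  · refine ⟨e, le_rfl, he, expand K (p ^ (n - e)) g, ?_⟩
    rw [expand_expand, ← pow_add, Nat.add_sub_cancel' h, hgx]

/-- The endomorphism of `L[X̄]` fixing `X̄` that extends a homomorphism `L → L[X̄]` over `K`. -/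
noncomputable def truncLift {n : ℕ} (φ : L →ₐ[K] Trunc L n) : Trunc L n →+* Trunc L n :=
  AdjoinRoot.lift (φ : L →+* Trunc L n) (AdjoinRoot.root (X ^ n)) <| by
    rw [eval₂_X_pow, ← AdjoinRoot.mk_X, ← map_pow, AdjoinRoot.mk_self]

@[simp]
theorem truncLift_of {n : ℕ} (φ : L →ₐ[K] Trunc L n) (x : L) :
    truncLift φ (AdjoinRoot.of _ x) = φ x :=
  AdjoinRoot.lift_of _

theorem truncLift_algebraMap {n : ℕ} (φ : L →ₐ[K] Trunc L n) (x : L) :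
    truncLift φ (algebraMap L _ x) = φ x :=
  AdjoinRoot.lift_of _

@[simp]
theorem truncLift_root {n : ℕ} (φ : L →ₐ[K] Trunc L n) :
    truncLift φ (AdjoinRoot.root (X ^ n)) = AdjoinRoot.root (X ^ n) :=
  AdjoinRoot.lift_root _

theorem truncLift_comp_truncMap {n : ℕ} (φ : L →ₐ[K] Trunc L n) :
    (truncLift φ).comp (truncMap K L n) = truncMap K L n := by
  refine AdjoinRoot.ringHom_ext (RingHom.ext fun x ↦ ?_) ?_
  · have : φ (algebraMap K L x) = AdjoinRoot.of _ (algebraMap K L x) := φ.commutes x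
    simpa [truncMap] using this
  · simp [truncMap]

theorem truncLift_comp_truncLift {n : ℕ} {φ ψ : L →ₐ[K] Trunc L n}
    (h : ∀ x, truncLift ψ (φ x) = algebraMap L _ x) :
    (truncLift ψ).comp (truncLift φ) = RingHom.id _ := by
  refine AdjoinRoot.ringHom_ext (RingHom.ext fun x ↦ ?_) ?_
  · simpa using h x
  · simp

/-- A pair of mutually inverse homomorphisms `L → L[X̄]` over `K` defines an automorphism of
`L[X̄]` over `K[X̄]`. -/
theorem exists_HG_of_algHom {p e : ℕ} {φ ψ : L →ₐ[K] Trunc L (p ^ e)}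
    (h₁ : ∀ x, truncLift ψ (φ x) = algebraMap L _ x)
    (h₂ : ∀ x, truncLift φ (ψ x) = algebraMap L _ x) :
    ∃ σ : HG K L p e, ∀ x, σ (algebraMap L _ x) = φ x :=
  ⟨AlgEquiv.ofRingEquiv (f := RingEquiv.ofRingHom (truncLift φ) (truncLift ψ)
    (truncLift_comp_truncLift h₂) (truncLift_comp_truncLift h₁))
    fun x ↦ DFunLike.congr_fun (truncLift_comp_truncMap φ) x, fun x ↦ truncLift_algebraMap φ x⟩

/-- An automorphism of `L / K` extends to an automorphism of `L[X̄] / K[X̄]`. -/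
theorem exists_HG_of_algEquiv (p e : ℕ) (τ : L ≃ₐ[K] L) :
    ∃ σ : HG K L p e, ∀ x, σ (algebraMap L _ x) = algebraMap L _ (τ x) := by
  refine exists_HG_of_algHom (φ := (IsScalarTower.toAlgHom K L _).comp τ.toAlgHom)
    (ψ := (IsScalarTower.toAlgHom K L _).comp τ.symm.toAlgHom) (fun x ↦ ?_) fun x ↦ ?_
  all_goals simp

/-- A polynomial over `L` of degree less than `p ^ m` that takes the same value at `x` and at
`x + X̄ ^ p ^ (e - m)` is constant. -/
theorem eq_C_of_aeval_add_root_pow {p : ℕ} [Fact p.Prime] {e m : ℕ} (hm : m ≤ e) {Q : L[X]}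
    (hQ : Q.natDegree < p ^ m) {x : L}
    (h : aeval (algebraMap L (Trunc L (p ^ e)) x + AdjoinRoot.root (X ^ p ^ e) ^ p ^ (e - m)) Q =
      algebraMap L _ (Q.eval x)) : Q = C (Q.coeff 0) := by
  have hp : 0 < p ^ (e - m) := pow_pos (Fact.out : p.Prime).pos _
  -- The value of Q at x + X̄^(p^(e-m)) is the class of the Taylor expansion in X^(p^(e-m)). Its
  -- degree is below p^e, so truncation loses nothing and the identity lifts to polynomials.
  have key : AdjoinRoot.mk (X ^ p ^ e)
      (expand L (p ^ (e - m)) (taylor x Q) - C (Q.eval x)) = 0 := by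
    rw [map_sub, sub_eq_zero, AdjoinRoot.mk_C, ← AdjoinRoot.algebraMap_eq, ← h,
      ← AdjoinRoot.aeval_eq, expand_aeval, taylor_apply, aeval_comp]
    simp [add_comm]
  have hdeg : (expand L (p ^ (e - m)) (taylor x Q) - C (Q.eval x)).natDegree < p ^ e := by
    rw [natDegree_sub_C, natDegree_expand, natDegree_taylor]
    calc _ < p ^ m * p ^ (e - m) := by gcongr
      _ = p ^ e := by rw [← pow_add, Nat.add_sub_cancel' hm]
  have h0 : expand L (p ^ (e - m)) (taylor x Q) = C (Q.eval x) := by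
    by_contra hne
    refine AdjoinRoot.mk_ne_zero_of_natDegree_lt (monic_X_pow (p ^ e)) (sub_ne_zero.mpr hne) ?_ key
    simpa using hdeg
  have h1 : taylor x Q = C (Q.eval x) := expand_injective hp (by rw [h0, expand_C])
  refine eq_C_of_natDegree_eq_zero ?_
  rw [← natDegree_taylor Q x, h1, natDegree_C]

theorem trunc_nontrivial (p : ℕ) [Fact p.Prime] (e : ℕ) : Nontrivial (Trunc L (p ^ e)) :=
  AdjoinRoot.nontrivial _ (by simpa using fun h ↦ absurd h (Fact.out : p.Prime).ne_zero)

/-- By additivity of Frobenius, the extra term acquires the factor X̄^(p^e) = 0. This dictates the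
exponent p^(e-m) of the shift. -/
theorem add_root_pow_mul_pow {p : ℕ} [Fact p.Prime] [CharP L p] {m e : ℕ} (hm : m ≤ e)
    (x y : Trunc L (p ^ e)) :
    (x + AdjoinRoot.root (X ^ p ^ e) ^ p ^ (e - m) * y) ^ p ^ m = x ^ p ^ m := by
  have := trunc_nontrivial (L := L) p e
  have : CharP (Trunc L (p ^ e)) p :=
    charP_of_injective_algebraMap (algebraMap L (Trunc L (p ^ e))).injective p
  rw [add_pow_char_pow, mul_pow, ← pow_mul, ← pow_add, Nat.sub_add_cancel hm, ← AdjoinRoot.mk_X,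
    ← map_pow, AdjoinRoot.mk_self, zero_mul, add_zero]

/-- The restriction to `L` of an automorphism of `L[X̄]` over `K[X̄]`. -/
noncomputable def HG_toAlgHom {p e : ℕ} (σ : HG K L p e) : L →ₐ[K] Trunc L (p ^ e) :=
  { (σ : Trunc L (p ^ e) →+* Trunc L (p ^ e)).comp (algebraMap L _) with
    commutes' := HG_apply_algebraMap σ }

/-- If `L` is generated by elements `β i` that can be moved independently, and `β i ^ p ^ m` is
separable, there is an automorphism of `L[X̄] / K[X̄]` fixing `β j` for `j ≠ i` and sending
`β i` to `β i + X̄ ^ p ^ (e - m)`. -/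
theorem exists_HG_shift (p : ℕ) [Fact p.Prime] [CharP K p] {ι : Type*} [DecidableEq ι]
    {β : ι → L} (htop : IntermediateField.adjoin K (Set.range β) = ⊤) [Algebra.IsAlgebraic K L]
    (hlift : ∀ (B : Type u) [CommRing B] [Algebra K B] (γ : ι → B),
        (∀ i, aeval (γ i) (minpoly K (β i)) = 0) → ∃ φ : L →ₐ[K] B, ∀ i, φ (β i) = γ i)
    (i : ι) {m e : ℕ} (hm : m ≤ e) {h : K[X]} (hh : minpoly K (β i) = expand K (p ^ m) h) :
    ∃ σ : HG K L p e, σ (algebraMap L _ (β i)) =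
        algebraMap L _ (β i) + AdjoinRoot.root (X ^ p ^ e) ^ p ^ (e - m) ∧
      ∀ j ≠ i, σ (algebraMap L _ (β j)) = algebraMap L _ (β j) := by
  have : CharP L p := charP_of_injective_algebraMap (algebraMap K L).injective p
  set r : Trunc L (p ^ e) := AdjoinRoot.root (X ^ p ^ e) ^ p ^ (e - m) with hr
  -- The minimal polynomial of β i only sees its p^m-th power, so every shift by c * r is again a
  -- root. The values c = 1 and c = -1 give mutually inverse maps.
  have main (c : ℤ) : ∃ φ : L →ₐ[K] Trunc L (p ^ e),
      ∀ j, φ (β j) = algebraMap L _ (β j) + if j = i then c * r else 0 := by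
    refine hlift _ _ fun j ↦ ?_
    have haev : aeval (algebraMap L (Trunc L (p ^ e)) (β j)) (minpoly K (β j)) = 0 := by
      rw [aeval_algebraMap_apply, minpoly.aeval, map_zero]
    split_ifs with hj
    · subst hj
      rw [hh, expand_aeval] at haev ⊢
      rw [mul_comm, add_root_pow_mul_pow hm, haev]
    · rwa [add_zero]
  have hext (φ ψ : L →ₐ[K] Trunc L (p ^ e)) (c : ℤ)
      (hφ : ∀ j, φ (β j) = algebraMap L _ (β j) + if j = i then c * r else 0)
      (hψ : ∀ j, ψ (β j) =
        algebraMap L _ (β j) + if j = i then ((-c : ℤ) : Trunc L (p ^ e)) * r else 0) (x : L) :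
      truncLift ψ (φ x) = algebraMap L _ x := by
    let f : L →ₐ[K] Trunc L (p ^ e) :=
      { (truncLift ψ).comp (φ : L →+* Trunc L (p ^ e)) with
        commutes' := fun a ↦ by
          have h1 : φ (algebraMap K L a) = algebraMap L _ (algebraMap K L a) := φ.commutes a
          have h2 : ψ (algebraMap K L a) = algebraMap L _ (algebraMap K L a) := ψ.commutes a
          change truncLift ψ (φ (algebraMap K L a)) = algebraMap L _ (algebraMap K L a)
          rw [h1, truncLift_algebraMap, h2] }
    have : f = IsScalarTower.toAlgHom K L _ := by
      have : Algebra.adjoin K (Set.range β) = ⊤ := by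
        rw [← IntermediateField.adjoin_toSubalgebra, htop, IntermediateField.top_toSubalgebra]
      refine AlgHom.ext_of_adjoin_eq_top this ?_
      rintro _ ⟨j, rfl⟩
      change truncLift ψ (φ (β j)) = algebraMap L _ (β j)
      rw [hφ, map_add, truncLift_algebraMap, hψ]
      split_ifs with hj
      · simp [hr]
      · simp
    exact DFunLike.congr_fun this x
  obtain ⟨φ, hφ⟩ := main 1
  obtain ⟨ψ, hψ⟩ := main (-1)
  obtain ⟨σ, hσ⟩ := exists_HG_of_algHom (hext φ ψ 1 hφ hψ) (hext ψ φ (-1) hψ (by simpa using hφ))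
  exact ⟨σ, by rw [hσ, hφ, if_pos rfl, Int.cast_one, one_mul],
    fun j hj ↦ by rw [hσ, hφ, if_neg hj, add_zero]⟩

/-- An element of a modular extension that is fixed by the Heerma-Galois group is separable. -/
theorem isSeparable_of_fixed (p : ℕ) [Fact p.Prime] [CharP K p] [FiniteDimensional K L]
    (hmod : IsModular K L) {e : ℕ} (he : ∀ x : L, IsSeparable K (x ^ p ^ e)) {b : L}
    (hb : ∀ σ : HG K L p e, σ (algebraMap L _ b) = algebraMap L _ b) : IsSeparable K b := by
  have : CharP L p := charP_of_injective_algebraMap (algebraMap K L).injective p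
  obtain ⟨n, β, htop, hlift⟩ := hmod.exists_generators
  choose m hm hsep h hh using fun i ↦
    exists_minpoly_eq_expand p (Algebra.IsIntegral.isIntegral (R := K) (β i)) (he (β i))
  -- Generators are replaced one at a time by their separable powers, without losing b; at the end
  -- only separable generators remain.
  have key (s : Finset (Fin n)) : b ∈ IntermediateField.adjoin K
      (Set.range fun i ↦ if i ∈ s then β i ^ p ^ m i else β i) := by
    induction s using Finset.induction_on with
    | empty => simp [htop]
    | insert i s his ih =>
      set F := IntermediateField.adjoin K
        (Set.range fun j ↦ if j ∈ insert i s then β j ^ p ^ m j else β j) with hF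
      have hmem (j : Fin n) : (if j ∈ insert i s then β j ^ p ^ m j else β j) ∈ F :=
        IntermediateField.subset_adjoin K _ ⟨j, rfl⟩
      have hi : β i ^ p ^ m i ∈ F := by simpa using hmem i
      obtain ⟨σ, hσi, hσ⟩ := exists_HG_shift p htop hlift i (hm i) (hh i)
      -- `b` is a polynomial in `β i` over `F` of degree less than `p ^ m i`
      obtain ⟨Q, hQdeg, hQ⟩ : ∃ Q : F[X], Q.natDegree < p ^ m i ∧ aeval (β i) Q = b := by
        have hle : (IntermediateField.adjoin K
            (Set.range fun j ↦ if j ∈ s then β j ^ p ^ m j else β j)).toSubalgebra ≤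
              (Algebra.adjoin F {β i}).restrictScalars K := by
          rw [IntermediateField.adjoin_toSubalgebra, Algebra.adjoin_le_iff]
          rintro _ ⟨j, rfl⟩
          by_cases hj : j = i
          · subst hj
            simp [his]
          · have : (if j ∈ s then β j ^ p ^ m j else β j) ∈ F := by
              simpa [Finset.mem_insert, hj] using hmem j
            exact (Algebra.adjoin F {β i}).algebraMap_mem ⟨_, this⟩
        obtain ⟨P, hP⟩ := (Algebra.adjoin_singleton_eq_range_aeval F (β i) ▸ hle ih :)
        have hpm : p ^ m i ≠ 0 := pow_ne_zero _ (Fact.out : p.Prime).ne_zero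
        -- This monic polynomial over F vanishes at β i, so reducing P modulo it bounds the degree
        -- without changing the value; it need not be minimal.
        have hmon : (X ^ p ^ m i - C (⟨β i ^ p ^ m i, hi⟩ : F)).Monic := monic_X_pow_sub_C _ hpm
        refine ⟨P %ₘ (X ^ p ^ m i - C ⟨β i ^ p ^ m i, hi⟩), ?_, ?_⟩
        · refine (natDegree_modByMonic_lt P hmon fun h1 ↦ hpm ?_).trans_eq natDegree_X_pow_sub_C
          rw [← natDegree_X_pow_sub_C (n := p ^ m i) (r := (⟨β i ^ p ^ m i, hi⟩ : F)), h1,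
            natDegree_one]
        · rw [aeval_modByMonic_eq_self_of_root]
          · exact hP
          · simp only [map_sub, map_pow, aeval_X, aeval_C]
            exact sub_self _
      -- the automorphism `σ` fixes `F`
      have hσF (x : F) : σ (algebraMap L _ (x : L)) = algebraMap L _ (x : L) := by
        have hle : F.toSubalgebra ≤ 
            AlgHom.equalizer (HG_toAlgHom σ) (IsScalarTower.toAlgHom K L _) := by
          rw [hF, IntermediateField.adjoin_toSubalgebra, Algebra.adjoin_le_iff]
          rintro _ ⟨j, rfl⟩
          change σ (algebraMap L _ (if j ∈ insert i s then β j ^ p ^ m j else β j)) =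
            algebraMap L _ (if j ∈ insert i s then β j ^ p ^ m j else β j)
          by_cases hj : j = i
          · subst hj
            rw [if_pos (Finset.mem_insert_self _ _), map_pow, map_pow, hσi]
            simpa using add_root_pow_mul_pow (L := L) (hm j) (algebraMap L _ (β j)) 1
          · split_ifs
            · rw [map_pow, map_pow, hσ j hj]
            · exact hσ j hj
        exact hle x.2
      let f : L →ₐ[F] Trunc L (p ^ e) :=
        { (σ : Trunc L (p ^ e) →+* Trunc L (p ^ e)).comp (algebraMap L _) with
          commutes' := hσF }
      -- As σ fixes b and the coefficients of Q, the value of Q is the same at β i and at its shift,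
      -- so Q is constant.
      have hmap : Q.map (algebraMap F L) = C ((Q.map (algebraMap F L)).coeff 0) := by
        refine eq_C_of_aeval_add_root_pow (e := e) (hm i) (by rwa [natDegree_map]) (x := β i) ?_
        have hf : f (aeval (β i) Q) = algebraMap L _ b := by rw [hQ]; exact hb σ
        rw [← aeval_algHom_apply] at hf
        rw [← hσi, aeval_map_algebraMap, eval_map_algebraMap, hQ]
        exact hf
      have : b = Q.coeff 0 := by
        rw [← hQ, ← aeval_map_algebraMap L, hmap]
        simp
      rw [this]
      exact (Q.coeff 0).2
  have hle : IntermediateField.adjoin K (Set.range fun i ↦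
      if i ∈ (Finset.univ : Finset (Fin n)) then β i ^ p ^ m i else β i) ≤ separableClosure K L := by
    rw [IntermediateField.adjoin_le_iff]
    rintro _ ⟨i, rfl⟩
    simpa [mem_separableClosure_iff] using hsep i
  exact mem_separableClosure_iff.mp (hle (key Finset.univ))

/-- The elements of `L` fixed by the Heerma-Galois group of a normal modular extension `L / K`
are the elements of `K`. -/
theorem mem_range_algebraMap_of_fixed (p : ℕ) [Fact p.Prime] [CharP K p] [FiniteDimensional K L]
    [Normal K L] (hmod : IsModular K L) {e : ℕ} (he : ∀ x : L, IsSeparable K (x ^ p ^ e)) {b : L}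
    (hb : ∀ σ : HG K L p e, σ (algebraMap L _ b) = algebraMap L _ b) :
    b ∈ (algebraMap K L).range := by
  by_contra hbK
  -- A separable element outside K has a second conjugate, which lies in L by normality.
  obtain ⟨y, hy, hyb⟩ := (notMem_iff_exists_ne_and_isConjRoot
    (isSeparable_of_fixed p hmod he hb) (Normal.splits inferInstance b)).mp
    (fun h ↦ hbK (by simpa [Algebra.mem_bot] using h))
  obtain ⟨τ, hτ⟩ := isConjRoot_iff_exists_algEquiv.mp hyb
  obtain ⟨σ, hσ⟩ := exists_HG_of_algEquiv p e τ
  have := trunc_nontrivial (L := L) p e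
  have h1 := hb σ
  rw [hσ] at h1
  have := (algebraMap L (Trunc L (p ^ e))).injective h1
  exact hy (τ.injective (this.trans hτ.symm))

/-! ### Galois descent for subspaces and ideals -/

section LinearAlgebra

variable {L M ι : Type*} [Field L] [AddCommGroup M] [Module L M]

/-- The action of an additive endomorphism of `L` on the coordinates with respect to a basis. -/
noncomputable def coordMap (b : Module.Basis ι L M) (D : L →+ L) : M →+ M :=
  b.repr.symm.toAddMonoidHom.comp ((Finsupp.mapRange.addMonoidHom D).comp b.repr.toAddMonoidHom)

theorem coordMap_smul (b : Module.Basis ι L M) (D : L →+ L) (c : L) (i : ι) :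
    coordMap b D (c • b i) = D c • b i := by
  simp [coordMap]

/-- A subspace stable under the coordinatewise action of a set of additive endomorphisms
`D` of `L` is spanned by vectors with coordinates in the subring `R`, if every `a` such that
`D a = D 1 * a` for all `D` belongs to `R`. -/
theorem le_span_of_coordMap_mem (R : Subring L) (b : Module.Basis ι L M) (W : Submodule L M)
    (S : Set (L →+ L)) (hS : ∀ a, (∀ D ∈ S, D a = D 1 * a) → a ∈ R)
    (hW : ∀ D ∈ S, ∀ x ∈ W, coordMap b D x ∈ W) :
    W ≤ Submodule.span L {y | y ∈ W ∧ ∀ i, b.repr y i ∈ R} := by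
  -- Choose basis vectors `b ∘ a` whose classes form a basis of M/W. Their span is a complement of
  -- W, and the `y i` below are the reduced echelon generators of W.
  obtain ⟨κ, a, -, hspan, hli⟩ := exists_linearIndependent' L (W.mkQ ∘ b)
  have htop : ⊤ ≤ Submodule.span L (Set.range ((W.mkQ ∘ b) ∘ a)) := by
    rw [hspan, Set.range_comp, Submodule.span_image, b.span_eq, Submodule.map_top,
      Submodule.range_mkQ]
  let c := Module.Basis.mk hli htop
  have hc (v : κ →₀ L) : W.mkQ (Finsupp.linearCombination L (b ∘ a) v) = c.repr.symm v := by
    rw [Finsupp.apply_linearCombination, Module.Basis.repr_symm_apply, Module.Basis.coe_mk]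
    rfl
  have hzero (v : κ →₀ L) (hv : Finsupp.linearCombination L (b ∘ a) v ∈ W) : v = 0 := by
    have : c.repr.symm v = 0 := by rwa [← hc, Submodule.mkQ_apply, Submodule.Quotient.mk_eq_zero]
    exact c.repr.symm.map_eq_zero_iff.mp this
  let A (i : ι) : κ →₀ L := c.repr (W.mkQ (b i))
  let y (i : ι) : M := b i - Finsupp.linearCombination L (b ∘ a) (A i)
  have hyW (i : ι) : y i ∈ W := by
    rw [← Submodule.Quotient.mk_eq_zero, ← Submodule.mkQ_apply, map_sub, hc]
    simp [A]
  have hlc (D : L →+ L) (v : κ →₀ L) : coordMap b D (Finsupp.linearCombination L (b ∘ a) v) =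
      Finsupp.linearCombination L (b ∘ a) (v.mapRange D (map_zero D)) := by
    induction v using Finsupp.induction_linear with
    | zero => simp
    | add v w hv hw => rw [map_add, map_add, hv, hw, Finsupp.mapRange_add (map_add D), map_add]
    | single k r => simp [coordMap_smul]
  have hA (i : ι) (k : κ) : A i k ∈ R := by
    refine hS _ fun D hD ↦ ?_
    -- The left side lies in W by stability. The coefficient 1 of `b i` cancels, so it also lies in
    -- the complement and therefore vanishes.
    have h1 : coordMap b D (y i) - D 1 • y i =
        Finsupp.linearCombination L (b ∘ a) (D 1 • A i - (A i).mapRange D (map_zero D)) := by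
      have : coordMap b D (b i) = D 1 • b i := by simpa using coordMap_smul b D 1 i
      rw [map_sub (Finsupp.linearCombination L (b ∘ a)), map_smul, map_sub (coordMap b D), this, hlc,
        smul_sub]
      abel
    have h2 := hzero _ (h1 ▸ W.sub_mem (hW D hD _ (hyW i)) (W.smul_mem _ (hyW i)))
    have := DFunLike.congr_fun h2 k
    simp only [Finsupp.coe_sub, Finsupp.coe_smul, Pi.sub_apply, Pi.smul_apply, smul_eq_mul,
      Finsupp.mapRange_apply, Finsupp.coe_zero, Pi.zero_apply] at this
    exact (sub_eq_zero.mp this).symm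
  have hyR (i j : ι) : b.repr (y i) j ∈ R := by
    classical
    have hb (i j : ι) : b.repr (b i) j ∈ R := by
      rw [b.repr_self, Finsupp.single_apply]
      split_ifs
      exacts [R.one_mem, R.zero_mem]
    rw [map_sub, Finsupp.sub_apply, Finsupp.linearCombination_apply, Finsupp.sum, map_sum,
      Finsupp.finsetSum_apply]
    refine R.sub_mem (hb i j) (R.sum_mem fun k _ ↦ ?_)
    rw [map_smul, Finsupp.smul_apply, smul_eq_mul]
    exact R.mul_mem (hA i k) (hb _ _)
  -- The projection onto W along the complement.
  let π : M →ₗ[L] M := b.constr L y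
  have hπW : LinearMap.range π ≤ Submodule.span L {y | y ∈ W ∧ ∀ i, b.repr y i ∈ R} := by
    rw [b.constr_range]
    refine Submodule.span_mono ?_
    rintro _ ⟨i, rfl⟩
    exact ⟨hyW i, hyR i⟩
  have hrange (x : M) : x - π x ∈ LinearMap.range (Finsupp.linearCombination L (b ∘ a)) := by
    have : x ∈ Submodule.span L (Set.range b) := b.span_eq ▸ Submodule.mem_top
    refine (Submodule.span_le (p := (LinearMap.range (Finsupp.linearCombination L (b ∘ a))).comap
      (LinearMap.id - π))).mpr ?_ this
    rintro _ ⟨i, rfl⟩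
    exact ⟨A i, by simp [π, y]⟩
  intro x hx
  obtain ⟨v, hv⟩ := hrange x
  have hπx : π x ∈ W := (hπW.trans (Submodule.span_le.mpr fun _ h ↦ h.1)) ⟨x, rfl⟩
  have hv0 : v = 0 := hzero v (hv ▸ W.sub_mem hx hπx)
  rw [hv0, map_zero, eq_comm, sub_eq_zero] at hv
  rw [hv]
  exact hπW ⟨x, rfl⟩

end LinearAlgebra

/-- Descent of ideals: let `B = A ⊗[K] L` and `C = B ⊗[L] T`, and let a set of endomorphisms of `T`
have no invariants in `L` but the elements of `K`. If the extension of an ideal `I` of `B`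
to `C = A ⊗[K] T` is stable under these endomorphisms, then `I` is extended from `A`. -/
theorem ideal_le_map_comap_of_stable {K L T A B C : Type*} [Field K] [Field L] [CommRing T]
    [CommRing A] [CommRing B] [CommRing C] [Algebra K L] [Algebra K A] [Algebra K B]
    [Algebra L B] [Algebra A B] [Algebra L T] [Algebra L C] [Algebra T C] [Algebra B C]
    [IsScalarTower K L B] [IsScalarTower K A B] [IsScalarTower L T C] [IsScalarTower L B C]
    (h₁ : Algebra.IsPushout K L A B) (h₂ : Algebra.IsPushout L B T C)
    {G : Type*} (σ : G → T →+* T) (τ : G → C →+* C)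
    (hfix : ∀ a : L, (∀ g, σ g (algebraMap L T a) = algebraMap L T a) →
      a ∈ (algebraMap K L).range)
    (hT : ∀ g t, τ g (algebraMap T C t) = algebraMap T C (σ g t))
    (hA : ∀ g a, τ g (algebraMap B C (algebraMap A B a)) = algebraMap B C (algebraMap A B a))
    (I : Ideal B)
    (hI : ∀ g, I.map (algebraMap B C) ≤ (I.map (algebraMap B C)).comap (τ g)) :
    I ≤ (I.comap (algebraMap A B)).map (algebraMap A B) := by
  let a := Module.Free.chooseBasis K A
  let b := h₁.out.basis a
  have hb (i) : b i = algebraMap A B (a i) := h₁.out.basis_apply a i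
  -- On coordinates, `D g l` is the composite of `τ g` with id ⊗ l. Since functionals separate the
  -- points of T, the condition D c = D 1 * c for all l says that `σ g` fixes c.
  let D (g : G) (l : T →ₗ[L] L) : L →+ L :=
    l.toAddMonoidHom.comp ((σ g).toAddMonoidHom.comp (algebraMap L T).toAddMonoidHom)
  let Λ (l : T →ₗ[L] L) : C →ₗ[B] B := h₂.out.lift ((Algebra.linearMap L B).comp l)
  have hΛ (l : T →ₗ[L] L) (t : T) : Λ l (algebraMap T C t) = algebraMap L B (l t) :=
    h₂.out.lift_eq _ t
  have hcoord (g : G) (l : T →ₗ[L] L) (x : B) :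
      coordMap b (D g l) x = Λ l (τ g (algebraMap B C x)) := by
    obtain ⟨v, rfl⟩ := b.repr.symm.surjective x
    induction v using Finsupp.induction_linear with
    | zero => simp
    | add v w hv hw => simp only [map_add, hv, hw]
    | single i c =>
      rw [Module.Basis.repr_symm_single, coordMap_smul, Algebra.smul_def c, map_mul, map_mul,
        ← IsScalarTower.algebraMap_apply L B C, IsScalarTower.algebraMap_apply L T C, hT, hb, hA,
        mul_comm, ← Algebra.smul_def (algebraMap A B (a i)), map_smul, hΛ, smul_eq_mul, mul_comm,
        Algebra.smul_def]
      rfl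
  have key := le_span_of_coordMap_mem (algebraMap K L).range b (I.restrictScalars L)
    {d | ∃ g l, d = D g l} (fun c hc ↦ hfix c fun g ↦ ?_) ?_
  · refine fun x hx ↦ (Submodule.span_le (p := Submodule.restrictScalars L
      ((I.comap (algebraMap A B)).map (algebraMap A B)))).mpr ?_ (key hx)
    rintro y ⟨hyI, hy⟩
    have hyA : y ∈ (algebraMap A B).range := by
      rw [← b.linearCombination_repr y, Finsupp.linearCombination_apply]
      refine Subring.sum_mem _ fun i _ ↦ ?_
      obtain ⟨k, hk⟩ := hy i
      refine ⟨k • a i, ?_⟩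
      dsimp only
      rw [← hk, hb, algebraMap_smul, Algebra.algebraMap_eq_smul_one, smul_assoc,
        ← Algebra.algebraMap_eq_smul_one]
    obtain ⟨z, rfl⟩ := hyA
    exact Ideal.mem_map_of_mem _ hyI
  · rw [← sub_eq_zero, ← Module.forall_dual_apply_eq_zero_iff L]
    intro l
    have h : l (σ g (algebraMap L T c)) = l (σ g (algebraMap L T 1)) * c := hc _ ⟨g, l, rfl⟩
    rw [map_sub, h, map_one, map_one, Algebra.algebraMap_eq_smul_one, map_smul, smul_eq_mul,
      mul_comm, sub_self]
  · rintro _ ⟨g, l, rfl⟩ x hx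
    rw [hcoord]
    have h := hI g (Ideal.mem_map_of_mem _ hx)
    rw [Ideal.mem_comap] at h
    -- `Λ l` is B-linear, so it sends the extension of I to C back into I.
    have h' : τ g (algebraMap B C x) ∈ I • (⊤ : Submodule B C) := by
      rwa [Ideal.smul_top_eq_map]
    refine Submodule.smul_induction_on h' (fun r hr c _ ↦ ?_) fun c d hc hd ↦ ?_
    · rw [map_smul]
      exact I.mul_mem_right _ hr
    · rw [map_add]
      exact I.add_mem hc hd

/-! ### Ideal sheaves and sections under affine base change -/

/-- If `C` is the pushout of `B` and the quotient `A'` of `A`, then the kernel of `B → C` is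
the extension of the kernel of `A → A'`. -/
theorem ker_eq_map_of_isPushout {A A' B C : CommRingCat.{u}} {f : A ⟶ B} {g : A ⟶ A'}
    {f' : A' ⟶ C} {g' : B ⟶ C} (h : IsPushout f g g' f') (hg : Function.Surjective g.hom) :
    RingHom.ker g'.hom = (RingHom.ker g.hom).map f.hom := by
  refine le_antisymm (fun x hx ↦ ?_) ?_
  · let q : B ⟶ CommRingCat.of (B ⧸ (RingHom.ker g.hom).map f.hom) :=
      CommRingCat.ofHom (Ideal.Quotient.mk _)
    have hle : RingHom.ker g.hom ≤ RingHom.ker (q.hom.comp f.hom) := fun a ha ↦ by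
      change Ideal.Quotient.mk _ (f.hom a) = 0
      rw [Ideal.Quotient.eq_zero_iff_mem]
      exact Ideal.mem_map_of_mem _ ha
    have hr : f ≫ q =
        g ≫ CommRingCat.ofHom (g.hom.liftOfSurjective hg ⟨q.hom.comp f.hom, hle⟩) := by
      ext a
      exact (g.hom.liftOfRightInverse_comp_apply _ (Function.rightInverse_surjInv hg)
        ⟨q.hom.comp f.hom, hle⟩ a).symm
    have h1 : g' ≫ h.desc _ _ hr = q := h.inl_desc _ _ hr
    have h2 : q.hom x = 0 := by
      have h0 : g'.hom x = 0 := hx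
      rw [← h1, CommRingCat.hom_comp, RingHom.comp_apply, h0, map_zero]
    exact Ideal.Quotient.eq_zero_iff_mem.mp h2
  · rw [Ideal.map_le_iff_le_comap]
    intro a ha
    have h1 : (f ≫ g').hom a = (g ≫ f').hom a := by rw [h.w]
    rw [CommRingCat.hom_comp, CommRingCat.hom_comp, RingHom.comp_apply, RingHom.comp_apply,
      (RingHom.mem_ker).mp ha, map_zero] at h1
    exact h1

/-- The inverse image ideal sheaf under an affine morphism `f` is given on the preimage of an
affine open by extension of ideals. -/
theorem ideal_comap_of_isAffineHom {X Y : Scheme.{u}} (I : Y.IdealSheafData) (f : X ⟶ Y)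
    [IsAffineHom f] (U : Y.affineOpens) :
    (I.comap f).ideal ⟨f ⁻¹ᵁ U, U.2.preimage f⟩ = (I.ideal U).map (f.app U).hom := by
  have H := IsPullback.of_hasPullback f I.subschemeι
  have hUST : I.subschemeι ⁻¹ᵁ U.1 ≤ I.subschemeι ⁻¹ᵁ U.1 := le_rfl
  have hUSX : f ⁻¹ᵁ U.1 ≤ f ⁻¹ᵁ U.1 := le_rfl
  have hUY : pullback.fst f I.subschemeι ⁻¹ᵁ (f ⁻¹ᵁ U.1) =
      pullback.fst f I.subschemeι ⁻¹ᵁ (f ⁻¹ᵁ U.1) ⊓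
        pullback.snd f I.subschemeι ⁻¹ᵁ (I.subschemeι ⁻¹ᵁ U.1) := by
    rw [← Scheme.Hom.comp_preimage, ← Scheme.Hom.comp_preimage, pullback.condition, inf_idem]
  -- Over affine opens the fibre product with the closed subscheme is a pushout of section rings,
  -- and the inverse image ideal is the kernel of one of its legs.
  have hp := (isIso_pushoutSection_iff H hUST hUSX hUY).mp
    (isIso_pushoutSection_of_isAffineOpen H hUST hUSX hUY U.2 (U.2.preimage _) (U.2.preimage f))
  have hk := ker_eq_map_of_isPushout hp (by
    rw [Scheme.Hom.appLE_eq_app]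
    exact I.subschemeι_app_surjective U)
  rw [Scheme.IdealSheafData.comap, Scheme.Hom.ker_apply]
  simp only [Scheme.Hom.appLE_eq_app] at hk
  rw [hk, Scheme.IdealSheafData.ker_subschemeι_app]

theorem le_preimage_top {X Y : Scheme.{u}} (f : X ⟶ Y) (U : X.Opens) : U ≤ f ⁻¹ᵁ ⊤ :=
  le_top

/-- The ring homomorphism `R → Γ(X, U)` for a scheme `X` over `Spec R`. -/
noncomputable def toSection {R : CommRingCat.{u}} {X : Scheme.{u}} (s : X ⟶ Spec R)
    (U : X.Opens) : R ⟶ Γ(X, U) :=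
  (Scheme.ΓSpecIso R).inv ≫ s.appLE ⊤ U (le_preimage_top s U)

theorem toSection_appLE {R : CommRingCat.{u}} {X Y : Scheme.{u}} (s : X ⟶ Spec R)
    (g : Y ⟶ X) (U : X.Opens) (V : Y.Opens) (h : V ≤ g ⁻¹ᵁ U) :
    toSection s U ≫ g.appLE U V h = toSection (g ≫ s) V := by
  rw [toSection, toSection, Category.assoc, Scheme.Hom.appLE_comp_appLE]

theorem toSection_comp_specMap {R S : CommRingCat.{u}} {X : Scheme.{u}} (s : X ⟶ Spec S)
    (φ : R ⟶ S) (U : X.Opens) : toSection (s ≫ Spec.map φ) U = φ ≫ toSection s U := by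
  rw [toSection, toSection, ← Category.assoc φ, Scheme.ΓSpecIso_inv_naturality, Category.assoc,
    ← Scheme.Hom.appLE_comp_appLE _ _ ⊤ ⊤ U (le_preimage_top _ _) (le_preimage_top _ _)]
  congr 2

/-- Sections of a base change over the preimage of an affine open. -/
theorem isPushout_toSection {R S : CommRingCat.{u}} {X Y : Scheme.{u}} {s : X ⟶ Spec R}
    {φ : R ⟶ S} {f : Y ⟶ X} {t : Y ⟶ Spec S} (H : IsPullback f t s (Spec.map φ)) {U : X.Opens}
    (hU : IsAffineOpen U) :
    IsPushout (toSection s U) φ (f.app U) (toSection t (f ⁻¹ᵁ U)) := by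
  have hUY : f ⁻¹ᵁ U = f ⁻¹ᵁ U ⊓ t ⁻¹ᵁ ⊤ := by simp
  have hp := (isIso_pushoutSection_iff H (le_preimage_top (Spec.map φ) ⊤)
    (le_preimage_top s U) hUY).mp
    (isIso_pushoutSection_of_isAffineOpen H _ _ hUY (isAffineOpen_top _)
      (isAffineOpen_top _) hU)
  refine hp.of_iso (Scheme.ΓSpecIso R) (Iso.refl _) (Scheme.ΓSpecIso S) (Iso.refl _) ?_ ?_ ?_ ?_
  · simp [toSection]
  · exact (congrArg (· ≫ _) (Scheme.Hom.appLE_eq_app (Spec.map φ))).trans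
      (Scheme.ΓSpecIso_naturality φ)
  · simp [Scheme.Hom.appLE_eq_app]
  · simp [toSection]

/-! ### Descent over an affine open of X -/

section

variable {K L : Type u} [Field K] [Field L] [Algebra K L]
  {X : Scheme.{u}} (s : X ⟶ Spec (CommRingCat.of K)) {p e : ℕ}

theorem isAffineHom_pullback_fst {X Y S : Scheme.{u}} (f : X ⟶ S) (g : Y ⟶ S) [IsAffineHom g] :
    IsAffineHom (pullback.fst f g) :=
  have := isAffineHom_isStableUnderBaseChange.{u}
  MorphismProperty.IsStableUnderBaseChange.of_isPullback (P := @IsAffineHom)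
    (IsPullback.of_hasPullback f g).flip ‹_›

instance : IsAffineHom (baseChangeFst L s) :=
  isAffineHom_pullback_fst _ _

instance : IsAffineHom (truncChangeFst L s p e) :=
  isAffineHom_pullback_fst _ _

instance (σ : HG K L p e) : IsIso (action s σ).hom :=
  Iso.isIso_hom (X := truncChange L s p e) (Y := truncChange L s p e) (action s σ)

theorem action_hom_comp_projection (σ : HG K L p e) :
    (action s σ).hom ≫ truncChangeFst L s p e ≫ baseChangeFst L s =
      truncChangeFst L s p e ≫ baseChangeFst L s :=
  actionMap_fst s σ⁻¹

theorem action_hom_comp_snd (σ : HG K L p e) :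
    (action s σ).hom ≫ truncChangeSnd L s p e = truncChangeSnd L s p e ≫ specMap σ⁻¹ :=
  actionMap_snd s σ⁻¹

theorem comap_comap_comap_of_comp_eq {X Y W : Scheme.{u}} {a : W ⟶ W} {g : W ⟶ Y} {f : Y ⟶ X}
    (h : a ≫ g ≫ f = g ≫ f) (J : X.IdealSheafData) :
    ((J.comap f).comap g).comap a = (J.comap f).comap g := by
  rw [← Scheme.IdealSheafData.comap_comp, ← Scheme.IdealSheafData.comap_comp, Category.assoc, h,
    Scheme.IdealSheafData.comap_comp]

theorem isStable_of_comap (Z₀ : X.IdealSheafData) :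
    IsStable s ((Z₀.comap (baseChangeFst L s)).comap (truncChangeFst L s p e)) := by
  intro σ
  exact comap_comap_comap_of_comp_eq (action_hom_comp_projection s σ) Z₀

/-- Since σ acts over X, preimages of opens of X are preserved; σ therefore acts on their sections
through `appLE`. -/
theorem le_preimage_action (σ : HG K L p e) (U : X.Opens) :
    truncChangeFst L s p e ⁻¹ᵁ (baseChangeFst L s ⁻¹ᵁ U) ≤
      (action s σ).hom ⁻¹ᵁ (truncChangeFst L s p e ⁻¹ᵁ (baseChangeFst L s ⁻¹ᵁ U)) := by
  rw [← Scheme.Hom.comp_preimage, ← Scheme.Hom.comp_preimage, action_hom_comp_projection]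

/-- If `J.comap a = J` for an endomorphism `a`, the ideals of `J` are stable under the action of
`a` on sections. -/
theorem ideal_le_comap_appLE {Y : Scheme.{u}} {a : Y ⟶ Y} [IsAffineHom a] {J : Y.IdealSheafData}
    (h : J.comap a ≤ J) (W : Y.affineOpens) (hW : W.1 ≤ a ⁻¹ᵁ W.1) :
    J.ideal W ≤ (J.ideal W).comap (a.appLE W W hW).hom := by
  have h1 := Scheme.IdealSheafData.le_map_iff_comap_le.mpr h W
  rw [Scheme.IdealSheafData.ideal_map_of_isAffineHom] at h1
  intro x hx
  have h2 : _ ∈ J.ideal ⟨a ⁻¹ᵁ W.1, W.2.preimage a⟩ := h1 hx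
  exact J.ideal_le_comap_ideal (U := W) (V := ⟨a ⁻¹ᵁ W.1, W.2.preimage a⟩) hW h2

theorem app_app_appLE_of_comp_eq {X Y W : Scheme.{u}} {a : W ⟶ W} {g : W ⟶ Y} {f : Y ⟶ X}
    (h : a ≫ g ≫ f = g ≫ f) (U : X.Opens) (hU : g ⁻¹ᵁ (f ⁻¹ᵁ U) ≤ a ⁻¹ᵁ (g ⁻¹ᵁ (f ⁻¹ᵁ U))) :
    f.app U ≫ g.app (f ⁻¹ᵁ U) ≫ a.appLE _ _ hU = f.app U ≫ g.app (f ⁻¹ᵁ U) := by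
  simp only [← Scheme.Hom.appLE_eq_app, Scheme.Hom.appLE_comp_appLE, Category.assoc, h]

/-- The local form of the descent: over an affine U, the sections on V and W are the base changes of
Γ(X, U) to L and L[X̄], so `ideal_le_map_comap_of_stable` applies. -/
theorem ideal_baseChange_le (p : ℕ) [Fact p.Prime] [CharP K p] [FiniteDimensional K L] [Normal K L]
    (hmod : IsModular K L) {e : ℕ} (he : ∀ x : L, IsSeparable K (x ^ p ^ e))
    (Z : (baseChange L s).IdealSheafData)
    (hZ : IsStable s (Z.comap (truncChangeFst L s p e))) (U : X.affineOpens) :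
    Z.ideal ⟨baseChangeFst L s ⁻¹ᵁ U, U.2.preimage _⟩ ≤
      ((Z.ideal ⟨baseChangeFst L s ⁻¹ᵁ U, U.2.preimage _⟩).comap
        ((baseChangeFst L s).app U).hom).map ((baseChangeFst L s).app U).hom := by
  let V : (baseChange L s).affineOpens := ⟨baseChangeFst L s ⁻¹ᵁ U, U.2.preimage _⟩
  let W : (truncChange L s p e).affineOpens := ⟨truncChangeFst L s p e ⁻¹ᵁ V, V.2.preimage _⟩
  have P₁ := isPushout_toSection (IsPullback.of_hasPullback s
    (Spec.map (CommRingCat.ofHom (algebraMap K L)))) U.2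
  have P₂ := isPushout_toSection (IsPullback.of_hasPullback (baseChangeSnd L s)
    (Spec.map (CommRingCat.ofHom (algebraMap L (Trunc L (p ^ e)))))) V.2
  let _ : Algebra K Γ(X, U) := (toSection s U).hom.toAlgebra
  let _ : Algebra Γ(X, U) Γ(baseChange L s, V) := ((baseChangeFst L s).app U).hom.toAlgebra
  let _ : Algebra L Γ(baseChange L s, V) := (toSection (baseChangeSnd L s) V).hom.toAlgebra
  let _ : Algebra K Γ(baseChange L s, V) :=
    ((toSection (baseChangeSnd L s) V).hom.comp (algebraMap K L)).toAlgebra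
  let _ : Algebra Γ(baseChange L s, V) Γ(truncChange L s p e, W) :=
    ((truncChangeFst L s p e).app V).hom.toAlgebra
  let _ : Algebra (Trunc L (p ^ e)) Γ(truncChange L s p e, W) :=
    (toSection (truncChangeSnd L s p e) W).hom.toAlgebra
  let _ : Algebra L Γ(truncChange L s p e, W) :=
    ((toSection (truncChangeSnd L s p e) W).hom.comp
      (algebraMap L (Trunc L (p ^ e)))).toAlgebra
  have : IsScalarTower K L Γ(baseChange L s, V) := .of_algebraMap_eq' rfl
  have : IsScalarTower K Γ(X, U) Γ(baseChange L s, V) :=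
    .of_algebraMap_eq' (congrArg CommRingCat.Hom.hom P₁.w).symm
  have : IsScalarTower L (Trunc L (p ^ e)) Γ(truncChange L s p e, W) := .of_algebraMap_eq' rfl
  have : IsScalarTower L Γ(baseChange L s, V) Γ(truncChange L s p e, W) :=
    .of_algebraMap_eq' (congrArg CommRingCat.Hom.hom P₂.w).symm
  have h₁ : Algebra.IsPushout K L Γ(X, U) Γ(baseChange L s, V) :=
    CommRingCat.isPushout_iff_isPushout.mp P₁.flip
  have h₂ : Algebra.IsPushout L Γ(baseChange L s, V) (Trunc L (p ^ e)) Γ(truncChange L s p e, W) :=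
    CommRingCat.isPushout_iff_isPushout.mp P₂
  have hideal : (Z.comap (truncChangeFst L s p e)).ideal W =
      (Z.ideal V).map (algebraMap Γ(baseChange L s, V) Γ(truncChange L s p e, W)) :=
    ideal_comap_of_isAffineHom Z (truncChangeFst L s p e) V
  refine ideal_le_map_comap_of_stable h₁ h₂
    (fun σ : HG K L p e ↦ ((σ⁻¹ : HG K L p e) : Trunc L (p ^ e) →+* Trunc L (p ^ e)))
    (fun σ : HG K L p e ↦ ((action s σ).hom.appLE W W (le_preimage_action s σ U)).hom)
    (fun a ha ↦ mem_range_algebraMap_of_fixed p hmod he fun σ ↦ ?_) (fun σ t ↦ ?_) (fun σ a ↦ ?_)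
    (Z.ideal V) (fun σ ↦ ?_)
  -- The action is through σ⁻¹, and invariance under all inverses is invariance under the whole
  -- group.
  · simpa using! ha σ⁻¹
  · have h := toSection_appLE (truncChangeSnd L s p e) (action s σ).hom W W
      (le_preimage_action s σ U)
    rw [action_hom_comp_snd, toSection_comp_specMap] at h
    exact congr($(h).hom t)
  · have h : (baseChangeFst L s).app U ≫ (truncChangeFst L s p e).app V ≫
        (action s σ).hom.appLE W W (le_preimage_action s σ U) =
          (baseChangeFst L s).app U ≫ (truncChangeFst L s p e).app V := 
      app_app_appLE_of_comp_eq (action_hom_comp_projection s σ) U.1 (le_preimage_action s σ U)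
    exact congr($(h).hom a)
  · rw [← hideal]
    exact ideal_le_comap_appLE (hZ σ).le W (le_preimage_action s σ U)

end

end HeermaGalois

/-- Closed subschemes are given by their quasi-coherent ideal sheaves (`IdealSheafData`), and
`comap` is the scheme-theoretic preimage (base change) of a closed subscheme. -/
theorem mainTheorem2 (p : ℕ) [Fact p.Prime] (K L : Type u) [Field K] [CharP K p] [Field L]
    [Algebra K L] [FiniteDimensional K L] [Normal K L] (hmod : HeermaGalois.IsModular K L)
    (e : ℕ) (he : ∀ x : L, IsSeparable K (x ^ p ^ e))
    (X : Scheme.{u}) (s : X ⟶ Spec (CommRingCat.of K)) [IsSeparated s]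
    (Z : (HeermaGalois.baseChange L s).IdealSheafData) :
    (∃ Z₀ : X.IdealSheafData, Z = Z₀.comap (HeermaGalois.baseChangeFst L s)) ↔
      HeermaGalois.IsStable s (Z.comap (HeermaGalois.truncChangeFst L s p e)) := by
  -- One inclusion is the adjunction between image and preimage; the other is checked on the affine
  -- cover by preimages of affine opens of X.
  refine ⟨fun ⟨Z₀, hZ⟩ ↦ hZ ▸ HeermaGalois.isStable_of_comap s Z₀, fun hZ ↦
    ⟨Z.map (HeermaGalois.baseChangeFst L s), le_antisymm ?_ (Z.comap_map_le _)⟩⟩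
  refine Scheme.IdealSheafData.le_of_iSup_eq_top
    (fun U : X.affineOpens ↦ ⟨HeermaGalois.baseChangeFst L s ⁻¹ᵁ U, U.2.preimage _⟩) ?_ fun U ↦ ?_
  · rw [← Scheme.Hom.preimage_iSup, iSup_affineOpens_eq_top, Scheme.Hom.preimage_top]
  · rw [HeermaGalois.ideal_comap_of_isAffineHom,
      Scheme.IdealSheafData.ideal_map_of_isAffineHom]
    exact HeermaGalois.ideal_baseChange_le s p hmod he Z hZ U
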